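/- Let $\mathcal H_A,\mathcal H_B,\mathcal H_C$ be finite-dimensional complex Hilbert spaces and let $\rho_{ABC},\sigma_{ABC}$ be states (positive semidefinite operators of trace one) on $\mathcal H_A\otimes\mathcal H_B\otimes\mathcal H_C$. Let $\sigma_{AC}=\operatorname{Tr}_B\sigma_{ABC}$, $\sigma_{BC}=\operatorname{Tr}_A\sigma_{ABC}$, $\sigma_C=\operatorname{Tr}_{AB}\sigma_{ABC}$ be the marginals of $\sigma_{ABC}$ (padded with identities to operators on the whole space), and put $$X=\exp(\log\sigma_{AC}-\log\sigma_C+\log\sigma_{BC}).$$ If $\sigma_{AC}$ or $\sigma_{BC}$ is singular, this is understood with $\log 0=-\infty$ and $\exp(-\infty)=0$: $X$ is the exponential of the compression of $\log\sigma_{AC}-\log\sigma_C+\log\sigma_{BC}$ to $\operatorname{supp}(\sigma_{AC})\cap\operatorname{supp}(\sigma_{BC})$ (a subspace of $\operatorname{supp}(\sigma_C)$, on which all three logarithms are finite), and is $0$ on the orthogonal complement of that subspace. Then $$S(\rho_{ABC}\|X)\;\ge\;-2\log\operatorname{Tr}\bigl(\sqrt{\rho_{ABC}}\sqrt X\bigr)\;\ge\;\bigl\|\sqrt{\rho_{ABC}}-\sqrt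 X\bigr\|_2^2\;\ge\;\tfrac14\,\bigl\|\rho_{ABC}-X\bigr\|_1^2 .$$ Here $\log$ is the natural logarithm, $-2\log 0=+\infty$, $S(\rho\|X)=\operatorname{Tr}\rho(\log\rho-\log X)$ if $\operatorname{supp}\rho\subseteq\operatorname{supp}X$ (with $\log$ taken on the supports) and $S(\rho\|X)=+\infty$ otherwise, $\|T\|_2=\sqrt{\operatorname{Tr}T^\dagger T}$, and $\|T\|_1=\operatorname{Tr}\sqrt{T^\dagger T}$. -/

import Mathlib

open scoped Kronecker ComplexOrder

namespace QInfo

/-- A quantum state on `ℂⁿ`: a positive semidefinite matrix of trace one. -/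
structure IsState {n : Type*} [Fintype n] (ρ : Matrix n n ℂ) : Prop where
  posSemidef : ρ.PosSemidef
  trace_eq_one : ρ.trace = 1

section functions

variable {n : Type*} [Fintype n] [DecidableEq n]

/-- The logarithm of a Hermitian matrix by functional calculus.
As `Real.log 0 = 0`, it is the logarithm on the support and `0` on the kernel;
below it is only ever evaluated on vectors of the support. -/
noncomputable def matLog (M : Matrix n n ℂ) : Matrix n n ℂ := cfc Real.log M

/-- The positive square root of a positive semidefinite matrix. -/
noncomputable def matSqrt (M : Matrix n n ℂ) : Matrix n n ℂ := cfc Real.sqrt M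

/-- The support of a Hermitian matrix, that is, its range. -/
noncomputable def supp (M : Matrix n n ℂ) : Submodule ℂ (EuclideanSpace ℂ n) :=
  LinearMap.range (Matrix.toEuclideanLin M)

/-- The matrix of the orthogonal projection onto a subspace. -/
noncomputable def projMatrix (K : Submodule ℂ (EuclideanSpace ℂ n)) : Matrix n n ℂ :=
  (Matrix.toEuclideanCLM (n := n) (𝕜 := ℂ)).symm K.starProjection

/-- The Hilbert–Schmidt norm `√(Tr T†T)`. -/
noncomputable def norm2 (T : Matrix n n ℂ) : ℝ :=
  Real.sqrt (Matrix.trace (T.conjTranspose * T)).re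

/-- The trace norm `Tr √(T†T)`. -/
noncomputable def norm1 (T : Matrix n n ℂ) : ℝ :=
  (Matrix.trace (matSqrt (T.conjTranspose * T))).re

/-- The overlap `Tr √ρ √σ`. -/
noncomputable def overlap (ρ σ : Matrix n n ℂ) : ℝ :=
  (Matrix.trace (matSqrt ρ * matSqrt σ)).re

open Classical in
/-- The quantum relative entropy: `Tr ρ (log ρ - log σ)` if the support of `ρ` is contained
in that of `σ`, and `+∞` otherwise. -/
noncomputable def relEntropy (ρ σ : Matrix n n ℂ) : EReal :=
  if supp ρ ≤ supp σ then
    (((Matrix.trace (ρ * (matLog ρ - matLog σ))).re : ℝ) : EReal)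
  else ⊤

/-- `exp (log M - log L + log N)` for positive semidefinite `M`, `L`, `N` with
`supp M ≤ supp L` and `supp N ≤ supp L`, where `log 0 = -∞` and `exp (-∞) = 0`: with `P` the
orthogonal projection onto `supp M ⊓ supp N`, where all three logarithms are finite, it is the
exponential of the compression of `log M - log L + log N` on that subspace, and `0` on the
orthogonal complement. -/
noncomputable def expLog (M L N : Matrix n n ℂ) : Matrix n n ℂ :=
  let P := projMatrix (supp M ⊓ supp N)
  P * NormedSpace.exp (P * (matLog M - matLog L + matLog N) * P) * P

/-- For invertible matrices `expLog` is literally the exponential. -/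
theorem expLog_of_isUnit {M L N : Matrix n n ℂ} (hM : IsUnit M) (hN : IsUnit N) :
    expLog M L N = NormedSpace.exp (matLog M - matLog L + matLog N) := by
  have key : ∀ A : Matrix n n ℂ, IsUnit A → supp A = ⊤ := by
    intro A hA
    refine LinearMap.range_eq_top.2 fun v => ?_
    obtain ⟨u, rfl⟩ := hA
    refine ⟨Matrix.toEuclideanLin (↑u⁻¹ : Matrix n n ℂ) v, ?_⟩
    simp [Matrix.toLpLin_apply, Matrix.mulVec_mulVec]
  have hP : projMatrix (⊤ : Submodule ℂ (EuclideanSpace ℂ n)) = 1 := by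
    simp only [projMatrix, Submodule.starProjection_top]
    exact map_one (Matrix.toEuclideanCLM (n := n) (𝕜 := ℂ)).symm
  simp [expLog, key M hM, key N hN, hP]

end functions

section tripartite

variable {a b c : Type*} [Fintype a] [Fintype b] [Fintype c]

/-- The marginal on `AC`: partial trace over `B`. -/
def margAC (σ : Matrix (a × b × c) (a × b × c) ℂ) : Matrix (a × c) (a × c) ℂ :=
  fun i j => ∑ y : b, σ (i.1, y, i.2) (j.1, y, j.2)

/-- The marginal on `BC`: partial trace over `A`. -/
def margBC (σ : Matrix (a × b × c) (a × b × c) ℂ) : Matrix (b × c) (b × c) ℂ :=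
  fun i j => ∑ x : a, σ (x, i) (x, j)

/-- The marginal on `C`: partial trace over `A` and `B`. -/
def margC (σ : Matrix (a × b × c) (a × b × c) ℂ) : Matrix c c ℂ :=
  fun i j => ∑ x : a, ∑ y : b, σ (x, y, i) (x, y, j)

variable [DecidableEq a] [DecidableEq b] [DecidableEq c]

/-- An operator on `AC`, tensored with the identity of `B`. -/
def liftAC (M : Matrix (a × c) (a × c) ℂ) : Matrix (a × b × c) (a × b × c) ℂ :=
  (M ⊗ₖ (1 : Matrix b b ℂ)).submatrix
    (fun i => ((i.1, i.2.2), i.2.1)) (fun i => ((i.1, i.2.2), i.2.1))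

/-- An operator on `BC`, tensored with the identity of `A`. -/
def liftBC (M : Matrix (b × c) (b × c) ℂ) : Matrix (a × b × c) (a × b × c) ℂ :=
  (1 : Matrix a a ℂ) ⊗ₖ M

/-- An operator on `C`, tensored with the identities of `A` and `B`. -/
def liftC (M : Matrix c c ℂ) : Matrix (a × b × c) (a × b × c) ℂ :=
  (1 : Matrix a a ℂ) ⊗ₖ ((1 : Matrix b b ℂ) ⊗ₖ M)

/-- `exp (log σ_AC - log σ_C + log σ_BC)` on `ABC`; the marginals are padded with identities. -/
noncomputable def expMarg (σ : Matrix (a × b × c) (a × b × c) ℂ) :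
    Matrix (a × b × c) (a × b × c) ℂ :=
  expLog (liftAC (margAC σ)) (liftC (margC σ)) (liftBC (margBC σ))

end tripartite

end QInfo

/-!
Write `X` for `expMarg σ`. The first inequality holds for every positive semidefinite `X`: with
`pᵢ`, `qⱼ` the eigenvalues of `ρ`, `X` and `wᵢⱼ = |⟨uᵢ, vⱼ⟩|²` for their eigenvectors, traces of the
form `Tr f(ρ) g(X)` are sums `∑ wᵢⱼ f(pᵢ) g(qⱼ)` (`trace_cfc_mul_cfc`), and Jensen's inequality for
the distribution `wᵢⱼ pᵢ` gives `neg_two_mul_log_overlap_le`. The other two inequalities need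
only that `X` is positive semidefinite with `Tr X ≤ 1`: with `F = Tr √ρ√X`, the second is
`-log F ≥ 1 - F` together with `‖√ρ - √X‖₂² = 1 + Tr X - 2F`, and the third, `norm1_sub_sq_le`,
is the Cauchy–Schwarz inequality for `ρ - X = ½ (DS + SD)` with `D = √ρ - √X`, `S = √ρ + √X`.

The core is therefore `trace_expMarg_le_one`. Since `log X` is the compression of
`log σ_AC - log σ_C + log σ_BC` (`matLog_expCompression`), and `X` lives on the subspace to which
one compresses, `Tr X (log X - log σ_AC + log σ_C - log σ_BC) = 0`. In terms of relative entropies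
this reads `S(X_ABC‖1 ⊗ σ_BC) - S(X_AC‖1 ⊗ σ_C) + S(X_AC‖σ_AC) = 0`. Taking the partial trace over
`B` does not increase the relative entropy, so the difference of the first two terms is nonnegative,
while Klein's inequality bounds the last one below by `Tr X - Tr σ`.

Monotonicity of the relative entropy (`entropyGap_restrict_le`) comes from a variational formula.
The derivative in `t` of `∑ wᵢⱼ pᵢ log (t pᵢ + qⱼ)` is
`∑ wᵢⱼ pᵢ² / (t pᵢ + qⱼ) = sup_Y (2 Re Tr ρY - t Tr ρY†Y - Tr σYY†)`,
which does not increase when `Y` is restricted to a subalgebra. Comparing the values at `t = 0`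
and the asymptotics for `t → ∞` yields the inequality. No invertibility is needed, only
`supp ρ ⊆ supp σ`, in the form `KerLE`.
-/

namespace QInfo

/-! ### Joint eigenvalue sums -/

section Spectral

open Matrix

variable {n : Type*} [Fintype n] [DecidableEq n] {ρ σ : Matrix n n ℂ}

/-- The transition matrix `UᴴV` between the eigenbases of two Hermitian matrices. -/
noncomputable def transition (hρ : ρ.IsHermitian) (hσ : σ.IsHermitian) : Matrix n n ℂ :=
  (hρ.eigenvectorUnitary : Matrix n n ℂ)ᴴ * (hσ.eigenvectorUnitary : Matrix n n ℂ)

/-- The weight `|⟨uᵢ, vⱼ⟩|²` of a pair of eigenvectors. -/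
noncomputable def weight (hρ : ρ.IsHermitian) (hσ : σ.IsHermitian) (i j : n) : ℝ :=
  Complex.normSq (transition hρ hσ i j)

lemma weight_nonneg (hρ : ρ.IsHermitian) (hσ : σ.IsHermitian) (i j : n) :
    0 ≤ weight hρ hσ i j := Complex.normSq_nonneg _

lemma eigenvectorUnitary_conjTranspose_mul (hρ : ρ.IsHermitian) :
    (hρ.eigenvectorUnitary : Matrix n n ℂ)ᴴ * (hρ.eigenvectorUnitary : Matrix n n ℂ) = 1 :=
  Unitary.coe_star_mul_self _

lemma eigenvectorUnitary_mul_conjTranspose (hρ : ρ.IsHermitian) :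
    (hρ.eigenvectorUnitary : Matrix n n ℂ) * (hρ.eigenvectorUnitary : Matrix n n ℂ)ᴴ = 1 :=
  Unitary.coe_mul_star_self _

lemma cfc_eq_conj (hρ : ρ.IsHermitian) (f : ℝ → ℝ) :
    cfc f ρ = (hρ.eigenvectorUnitary : Matrix n n ℂ) *
      diagonal (fun i => (f (hρ.eigenvalues i) : ℂ)) *
        (hρ.eigenvectorUnitary : Matrix n n ℂ)ᴴ := by
  rw [hρ.cfc_eq]
  rfl

lemma eq_conj (hρ : ρ.IsHermitian) :
    ρ = (hρ.eigenvectorUnitary : Matrix n n ℂ) *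
      diagonal (fun i => (hρ.eigenvalues i : ℂ)) *
        (hρ.eigenvectorUnitary : Matrix n n ℂ)ᴴ := by
  conv_lhs => rw [← cfc_id ℝ ρ hρ.isSelfAdjoint]
  exact cfc_eq_conj hρ id

lemma continuousOn_spectrum (ρ : Matrix n n ℂ) (f : ℝ → ℝ) : ContinuousOn f (spectrum ℝ ρ) :=
  ρ.finite_real_spectrum.continuousOn f

/-- Two functions of two Hermitian matrices are paired under the trace like functions of two
random variables with joint distribution `|⟨uᵢ, vⱼ⟩|²`. -/
lemma trace_cfc_mul_cfc (hρ : ρ.IsHermitian) (hσ : σ.IsHermitian) (f g : ℝ → ℝ) :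
    (trace (cfc f ρ * cfc g σ)).re =
      ∑ i, ∑ j, weight hρ hσ i j * (f (hρ.eigenvalues i) * g (hσ.eigenvalues j)) := by
  have h : trace (cfc f ρ * cfc g σ) = trace (diagonal (fun i => (f (hρ.eigenvalues i) : ℂ)) *
      (transition hρ hσ * (diagonal (fun i => (g (hσ.eigenvalues i) : ℂ)) *
        (transition hρ hσ)ᴴ))) := by
    rw [cfc_eq_conj hρ, cfc_eq_conj hσ, transition, conjTranspose_mul, conjTranspose_conjTranspose]
    simp only [Matrix.mul_assoc]
    rw [trace_mul_comm]
    simp only [Matrix.mul_assoc]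
  rw [h, trace, Complex.re_sum]
  refine Finset.sum_congr rfl fun i _ => ?_
  rw [diag_apply, diagonal_mul, mul_apply, Complex.re_ofReal_mul, Complex.re_sum, Finset.mul_sum]
  refine Finset.sum_congr rfl fun j _ => ?_
  rw [diagonal_mul, conjTranspose_apply, mul_left_comm, Complex.star_def, Complex.mul_conj,
    ← Complex.ofReal_mul, Complex.ofReal_re, weight]
  ring

lemma trace_mul_cfc (hρ : ρ.IsHermitian) (hσ : σ.IsHermitian) (g : ℝ → ℝ) :
    (trace (ρ * cfc g σ)).re =
      ∑ i, ∑ j, weight hρ hσ i j * (hρ.eigenvalues i * g (hσ.eigenvalues j)) := by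
  have := trace_cfc_mul_cfc hρ hσ id g
  rwa [cfc_id ℝ ρ hρ.isSelfAdjoint] at this

lemma trace_cfc_left (hρ : ρ.IsHermitian) (hσ : σ.IsHermitian) (f : ℝ → ℝ) :
    (trace (cfc f ρ)).re = ∑ i, ∑ j, weight hρ hσ i j * f (hρ.eigenvalues i) := by
  have := trace_cfc_mul_cfc hρ hσ f (fun _ => 1)
  rw [cfc_const_one ℝ σ hσ.isSelfAdjoint] at this
  simpa using this

lemma trace_cfc_right (hρ : ρ.IsHermitian) (hσ : σ.IsHermitian) (g : ℝ → ℝ) :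
    (trace (cfc g σ)).re = ∑ i, ∑ j, weight hρ hσ i j * g (hσ.eigenvalues j) := by
  have := trace_cfc_mul_cfc hρ hσ (fun _ => 1) g
  rw [cfc_const_one ℝ ρ hρ.isSelfAdjoint] at this
  simpa using this

lemma trace_left (hρ : ρ.IsHermitian) (hσ : σ.IsHermitian) :
    (trace ρ).re = ∑ i, ∑ j, weight hρ hσ i j * hρ.eigenvalues i := by
  have := trace_cfc_left hρ hσ id
  rwa [cfc_id ℝ ρ hρ.isSelfAdjoint] at this

lemma trace_right (hρ : ρ.IsHermitian) (hσ : σ.IsHermitian) :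
    (trace σ).re = ∑ i, ∑ j, weight hρ hσ i j * hσ.eigenvalues j := by
  have := trace_cfc_right hρ hσ id
  rwa [cfc_id ℝ σ hσ.isSelfAdjoint] at this

/-- `ker σ ⊆ ker ρ`, expressed through matrix products so that it is transported by algebra
homomorphisms. -/
def KerLE (σ ρ : Matrix n n ℂ) : Prop := ∀ Y : Matrix n n ℂ, σ * Y = 0 → ρ * Y = 0

lemma weight_mul_eq_zero (hρ : ρ.IsHermitian) (hσ : σ.IsHermitian) (h : KerLE σ ρ) (i j : n)
    (hj : hσ.eigenvalues j = 0) : weight hρ hσ i j * hρ.eigenvalues i = 0 := by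
  -- the matrix `V eⱼⱼ`, whose only nonzero column is the `j`-th eigenvector of `σ`
  have h1 := h ((hσ.eigenvectorUnitary : Matrix n n ℂ) * single j j 1) (by
    conv_lhs => enter [1]; rw [eq_conj hσ]
    rw [Matrix.mul_assoc, ← Matrix.mul_assoc _ _ (single j j 1),
      eigenvectorUnitary_conjTranspose_mul, Matrix.one_mul, Matrix.mul_assoc]
    have : diagonal (fun i => (hσ.eigenvalues i : ℂ)) * single j j 1 = 0 := by
      ext k l
      rw [diagonal_mul, single_apply]
      split_ifs with hk
      · simp [← hk.1, hj]
      · simp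
    rw [this, Matrix.mul_zero])
  have h2 : diagonal (fun i => (hρ.eigenvalues i : ℂ)) * transition hρ hσ * single j j 1 = 0 := by
    have := congrArg (fun M => (hρ.eigenvectorUnitary : Matrix n n ℂ)ᴴ * M) h1
    simp only [Matrix.mul_zero] at this
    rw [← this]
    conv_rhs => enter [2, 1]; rw [eq_conj hρ]
    simp only [← Matrix.mul_assoc]
    rw [eigenvectorUnitary_conjTranspose_mul, Matrix.one_mul, transition]
    simp only [← Matrix.mul_assoc]
  have h3 := congrFun (congrFun h2 i) j
  rw [mul_single_apply_same, diagonal_mul] at h3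
  rw [mul_one, Matrix.zero_apply] at h3
  rcases mul_eq_zero.1 h3 with h | h
  · simp [Complex.ofReal_eq_zero.1 h]
  · simp [weight, h]

end Spectral

/-! ### Relative entropy, overlap and Klein's inequality -/

section Entropy

open Matrix

variable {n : Type*} [Fintype n] [DecidableEq n] {ρ σ : Matrix n n ℂ}

/-- The finite branch `Tr ρ (log ρ - log σ)` of the relative entropy. -/
noncomputable def entropyGap (ρ σ : Matrix n n ℂ) : ℝ :=
  (trace (ρ * (matLog ρ - matLog σ))).re

lemma trace_mul_cfc_self (hρ : ρ.IsHermitian) (hσ : σ.IsHermitian) (f : ℝ → ℝ) :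
    (trace (ρ * cfc f ρ)).re =
      ∑ i, ∑ j, weight hρ hσ i j * (hρ.eigenvalues i * f (hρ.eigenvalues i)) := by
  have h : ρ * cfc f ρ = cfc (fun x => x * f x) ρ := by
    rw [cfc_mul (fun x => x) f ρ (continuousOn_spectrum _ _) (continuousOn_spectrum _ _),
      cfc_id' ℝ ρ hρ.isSelfAdjoint]
  rw [h, trace_cfc_left hρ hσ]

lemma entropyGap_eq_sum (hρ : ρ.IsHermitian) (hσ : σ.IsHermitian) :
    entropyGap ρ σ = ∑ i, ∑ j, weight hρ hσ i j *
      (hρ.eigenvalues i * (Real.log (hρ.eigenvalues i) - Real.log (hσ.eigenvalues j))) := by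
  rw [entropyGap, Matrix.mul_sub, trace_sub, Complex.sub_re, matLog, matLog,
    trace_mul_cfc_self hρ hσ, trace_mul_cfc hρ hσ]
  simp only [← Finset.sum_sub_distrib]
  refine Finset.sum_congr rfl fun i _ => Finset.sum_congr rfl fun j _ => ?_
  ring

/-- Klein's inequality, for matrices of arbitrary trace. -/
lemma trace_sub_trace_le_entropyGap (hρ : ρ.PosSemidef) (hσ : σ.PosSemidef) (h : KerLE σ ρ) :
    (trace ρ).re - (trace σ).re ≤ entropyGap ρ σ := by
  rw [entropyGap_eq_sum hρ.1 hσ.1, trace_left hρ.1 hσ.1, trace_right hρ.1 hσ.1]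
  simp only [← Finset.sum_sub_distrib]
  refine Finset.sum_le_sum fun i _ => Finset.sum_le_sum fun j _ => ?_
  rw [← mul_sub]
  have hp := hρ.eigenvalues_nonneg i
  have hq := hσ.eigenvalues_nonneg j
  have hw := weight_nonneg hρ.1 hσ.1 i j
  rcases hp.eq_or_lt with hp0 | hp0
  · rw [← hp0]
    nlinarith [mul_nonneg hw hq]
  rcases hq.eq_or_lt with hq0 | hq0
  · have : weight hρ.1 hσ.1 i j = 0 :=
      (mul_eq_zero.1 (weight_mul_eq_zero hρ.1 hσ.1 h i j hq0.symm)).resolve_right hp0.ne'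
    simp [this]
  · refine mul_le_mul_of_nonneg_left ?_ hw
    have h1 := Real.log_le_sub_one_of_pos (div_pos hq0 hp0)
    rw [Real.log_div hq0.ne' hp0.ne'] at h1
    have h2 := mul_le_mul_of_nonneg_left h1 hp
    rw [mul_sub, mul_sub, mul_div_cancel₀ _ hp0.ne'] at h2
    linarith

lemma overlap_eq_sum (hρ : ρ.IsHermitian) (hσ : σ.IsHermitian) :
    overlap ρ σ = ∑ i, ∑ j, weight hρ hσ i j *
      (Real.sqrt (hρ.eigenvalues i) * Real.sqrt (hσ.eigenvalues j)) :=
  trace_cfc_mul_cfc hρ hσ _ _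

lemma overlap_pos (hρ : IsState ρ) (hσ : σ.PosSemidef) (h : KerLE σ ρ) : 0 < overlap ρ σ := by
  have hH := hρ.posSemidef.1
  rw [overlap_eq_sum hH hσ.1]
  have hnn : ∀ i j, 0 ≤ weight hH hσ.1 i j *
      (Real.sqrt (hH.eigenvalues i) * Real.sqrt (hσ.1.eigenvalues j)) := fun i j =>
    mul_nonneg (weight_nonneg _ _ _ _) (mul_nonneg (Real.sqrt_nonneg _) (Real.sqrt_nonneg _))
  -- if all products vanish, so do all `wᵢⱼ pᵢ`, contradicting `Tr ρ = 1`
  refine (Finset.sum_nonneg fun i _ => Finset.sum_nonneg fun j _ => hnn i j).lt_of_ne fun h0 => ?_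
  have hz : ∀ i j, weight hH hσ.1 i j * hH.eigenvalues i = 0 := by
    intro i j
    have h1 := (Finset.sum_eq_zero_iff_of_nonneg
      (fun i _ => Finset.sum_nonneg fun j _ => hnn i j)).1 h0.symm i (Finset.mem_univ _)
    have h2 := (Finset.sum_eq_zero_iff_of_nonneg (fun j _ => hnn i j)).1 h1 j (Finset.mem_univ _)
    rcases mul_eq_zero.1 h2 with h3 | h3
    · simp [h3]
    rcases mul_eq_zero.1 h3 with h4 | h4
    · rw [Real.sqrt_eq_zero (hρ.posSemidef.eigenvalues_nonneg i)] at h4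
      simp [h4]
    · rw [Real.sqrt_eq_zero (hσ.eigenvalues_nonneg j)] at h4
      exact weight_mul_eq_zero hH hσ.1 h i j h4
  have := trace_left hH hσ.1
  simp [hz, hρ.trace_eq_one] at this

/-- The relative entropy dominates the Rényi divergence of order `1/2`: Jensen's inequality for
the distribution `|⟨uᵢ, vⱼ⟩|² pᵢ`. -/
lemma neg_two_mul_log_overlap_le (hρ : IsState ρ) (hσ : σ.PosSemidef) (h : KerLE σ ρ) :
    -(2 * Real.log (overlap ρ σ)) ≤ entropyGap ρ σ := by
  have hH := hρ.posSemidef.1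
  have hF := overlap_pos hρ hσ h
  set F := overlap ρ σ with hFdef
  -- the tangent line of `log` at the mean `F` bounds every term
  have key : ∀ i j, weight hH hσ.1 i j * (hH.eigenvalues i *
        (Real.log (hσ.1.eigenvalues j) - Real.log (hH.eigenvalues i))) ≤
      2 / F * (weight hH hσ.1 i j *
        (Real.sqrt (hH.eigenvalues i) * Real.sqrt (hσ.1.eigenvalues j))) +
      (2 * Real.log F - 2) * (weight hH hσ.1 i j * hH.eigenvalues i) := by
    intro i j
    have hp := hρ.posSemidef.eigenvalues_nonneg i
    have hq := hσ.eigenvalues_nonneg j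
    have hw := weight_nonneg hH hσ.1 i j
    rcases hp.eq_or_lt with hp0 | hp0
    · simp [← hp0]
    rcases hq.eq_or_lt with hq0 | hq0
    · have : weight hH hσ.1 i j = 0 :=
        (mul_eq_zero.1 (weight_mul_eq_zero hH hσ.1 h i j hq0.symm)).resolve_right hp0.ne'
      simp [this]
    have h1 := Real.log_le_sub_one_of_pos
      (div_pos (Real.sqrt_pos.2 hq0) (mul_pos (Real.sqrt_pos.2 hp0) hF))
    rw [Real.log_div (Real.sqrt_pos.2 hq0).ne' (mul_pos (Real.sqrt_pos.2 hp0) hF).ne',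
      Real.log_mul (Real.sqrt_pos.2 hp0).ne' hF.ne', Real.log_sqrt hp, Real.log_sqrt hq] at h1
    have h2 := mul_le_mul_of_nonneg_left h1 (mul_nonneg hw hp)
    have h3 : weight hH hσ.1 i j * hH.eigenvalues i *
        (√(hσ.1.eigenvalues j) / (√(hH.eigenvalues i) * F)) =
        1 / F * (weight hH hσ.1 i j * (√(hH.eigenvalues i) * √(hσ.1.eigenvalues j))) := by
      have h4 := Real.mul_self_sqrt hp
      have h5 := (Real.sqrt_pos.2 hp0).ne'
      field_simp
      rw [sq, h4]
    rw [mul_sub _ _ (1 : ℝ), h3] at h2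
    have h6 : 2 / F = 2 * (1 / F) := by ring
    rw [h6]
    linarith
  have hsum := Finset.sum_le_sum fun i (_ : i ∈ Finset.univ) =>
    Finset.sum_le_sum fun j (_ : j ∈ Finset.univ) => key i j
  simp only [Finset.sum_add_distrib, ← Finset.mul_sum] at hsum
  rw [← overlap_eq_sum hH hσ.1, ← hFdef, div_mul_cancel₀ _ hF.ne', ← trace_left hH hσ.1,
    hρ.trace_eq_one] at hsum
  have hE := entropyGap_eq_sum hH hσ.1
  have hneg : entropyGap ρ σ = -∑ i, ∑ j, weight hH hσ.1 i j * (hH.eigenvalues i *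
        (Real.log (hσ.1.eigenvalues j) - Real.log (hH.eigenvalues i))) := by
    rw [hE]
    simp only [← Finset.sum_neg_distrib]
    refine Finset.sum_congr rfl fun i _ => Finset.sum_congr rfl fun j _ => ?_
    ring
  rw [Complex.one_re] at hsum
  linarith

end Entropy

/-! ### A variational formula -/

section Variational

open Matrix

variable {n : Type*} [Fintype n] [DecidableEq n] {ρ σ : Matrix n n ℂ}

/-- The concave quadratic functional whose supremum over `Y` is the `t`-derivative of `logSum`.
It involves only traces against `ρ` and `σ`, so it is compatible with restriction to a
subalgebra. -/
noncomputable def quadForm (ρ σ : Matrix n n ℂ) (t : ℝ) (Y : Matrix n n ℂ) : ℝ :=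
  2 * (trace (ρ * Y)).re - t * (trace (ρ * (Yᴴ * Y))).re - (trace (σ * (Y * Yᴴ))).re

lemma trace_diagonal_mul_self (d : n → ℝ) (A : Matrix n n ℂ) :
    (trace (diagonal (fun i => (d i : ℂ)) * (A * Aᴴ))).re =
      ∑ i, ∑ j, d i * Complex.normSq (A i j) := by
  rw [trace, Complex.re_sum]
  refine Finset.sum_congr rfl fun i _ => ?_
  rw [diag_apply, diagonal_mul, mul_apply, Complex.re_ofReal_mul, Complex.re_sum, Finset.mul_sum]
  refine Finset.sum_congr rfl fun j _ => ?_
  rw [conjTranspose_apply, Complex.star_def, Complex.mul_conj, Complex.ofReal_re]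

/-- The functional in coordinates: `Z` is the matrix of `Y` from the eigenbasis of `ρ` to that
of `σ`, and the entries of `Z` decouple. -/
lemma quadForm_eq_sum (hρ : ρ.IsHermitian) (hσ : σ.IsHermitian) (t : ℝ) (Z : Matrix n n ℂ) :
    quadForm ρ σ t ((hσ.eigenvectorUnitary : Matrix n n ℂ) * Z *
        (hρ.eigenvectorUnitary : Matrix n n ℂ)ᴴ) =
      ∑ i, ∑ j, (2 * (hρ.eigenvalues i * (transition hρ hσ i j * Z j i).re) -
        (t * hρ.eigenvalues i + hσ.eigenvalues j) * Complex.normSq (Z j i)) := by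
  set U := (hρ.eigenvectorUnitary : Matrix n n ℂ) with hU
  set V := (hσ.eigenvectorUnitary : Matrix n n ℂ) with hV
  have hUU : Uᴴ * U = 1 := eigenvectorUnitary_conjTranspose_mul hρ
  have hVV : Vᴴ * V = 1 := eigenvectorUnitary_conjTranspose_mul hσ
  have eρ := eq_conj hρ
  have eσ := eq_conj hσ
  rw [← hU] at eρ
  rw [← hV] at eσ
  have cU : ∀ B : Matrix n n ℂ, Uᴴ * (U * B) = B := fun B => by
    rw [← Matrix.mul_assoc, hUU, Matrix.one_mul]
  have cV : ∀ B : Matrix n n ℂ, Vᴴ * (V * B) = B := fun B => by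
    rw [← Matrix.mul_assoc, hVV, Matrix.one_mul]
  have t1 : (trace (ρ * (V * Z * Uᴴ))).re =
      ∑ i, ∑ j, hρ.eigenvalues i * (transition hρ hσ i j * Z j i).re := by
    have : trace (ρ * (V * Z * Uᴴ)) =
        trace (diagonal (fun i => (hρ.eigenvalues i : ℂ)) * (transition hρ hσ * Z)) := by
      conv_lhs => enter [1, 1]; rw [eρ]
      simp only [Matrix.mul_assoc]
      rw [trace_mul_comm]
      simp only [Matrix.mul_assoc]
      rw [hUU, Matrix.mul_one, transition, Matrix.mul_assoc]
    rw [this, trace, Complex.re_sum]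
    refine Finset.sum_congr rfl fun i _ => ?_
    rw [diag_apply, diagonal_mul, mul_apply, Complex.re_ofReal_mul, Complex.re_sum, Finset.mul_sum]
  have t2 : (trace (ρ * ((V * Z * Uᴴ)ᴴ * (V * Z * Uᴴ)))).re =
      ∑ i, ∑ j, hρ.eigenvalues i * Complex.normSq (Z j i) := by
    have : trace (ρ * ((V * Z * Uᴴ)ᴴ * (V * Z * Uᴴ))) =
        trace (diagonal (fun i => (hρ.eigenvalues i : ℂ)) * (Zᴴ * Zᴴᴴ)) := by
      conv_lhs => enter [1, 1]; rw [eρ]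
      simp only [conjTranspose_mul, conjTranspose_conjTranspose, Matrix.mul_assoc]
      rw [trace_mul_comm]
      simp only [Matrix.mul_assoc, cU, cV]
      rw [hUU, Matrix.mul_one]
    rw [this, trace_diagonal_mul_self]
    simp [Complex.normSq_conj]
  have t3 : (trace (σ * ((V * Z * Uᴴ) * (V * Z * Uᴴ)ᴴ))).re =
      ∑ i, ∑ j, hσ.eigenvalues j * Complex.normSq (Z j i) := by
    have : trace (σ * ((V * Z * Uᴴ) * (V * Z * Uᴴ)ᴴ)) =
        trace (diagonal (fun i => (hσ.eigenvalues i : ℂ)) * (Z * Zᴴ)) := by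
      conv_lhs => enter [1, 1]; rw [eσ]
      simp only [conjTranspose_mul, conjTranspose_conjTranspose, Matrix.mul_assoc]
      rw [trace_mul_comm]
      simp only [Matrix.mul_assoc, cU, cV]
      rw [hVV, Matrix.mul_one]
    rw [this, trace_diagonal_mul_self, Finset.sum_comm]
  rw [quadForm, t1, t2, t3]
  simp only [Finset.mul_sum, ← Finset.sum_sub_distrib]
  refine Finset.sum_congr rfl fun i _ => Finset.sum_congr rfl fun j _ => ?_
  ring

/-- The maximum of `quadForm ρ σ t`, namely `∑ᵢⱼ wᵢⱼ pᵢ² / (t pᵢ + qⱼ)`. -/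
noncomputable def quadMax (hρ : ρ.IsHermitian) (hσ : σ.IsHermitian) (t : ℝ) : ℝ :=
  ∑ i, ∑ j, weight hρ hσ i j *
    (hρ.eigenvalues i ^ 2 / (t * hρ.eigenvalues i + hσ.eigenvalues j))

lemma quadForm_le_quadMax (hρ : ρ.PosSemidef) (hσ : σ.PosSemidef) {t : ℝ} (ht : 0 < t)
    (Y : Matrix n n ℂ) : quadForm ρ σ t Y ≤ quadMax hρ.1 hσ.1 t := by
  have hY : Y = (hσ.1.eigenvectorUnitary : Matrix n n ℂ) *
      ((hσ.1.eigenvectorUnitary : Matrix n n ℂ)ᴴ * Y * (hρ.1.eigenvectorUnitary : Matrix n n ℂ)) *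
        (hρ.1.eigenvectorUnitary : Matrix n n ℂ)ᴴ := by
    simp only [Matrix.mul_assoc]
    rw [eigenvectorUnitary_mul_conjTranspose, Matrix.mul_one, ← Matrix.mul_assoc,
      eigenvectorUnitary_mul_conjTranspose, Matrix.one_mul]
  generalize (hσ.1.eigenvectorUnitary : Matrix n n ℂ)ᴴ * Y *
    (hρ.1.eigenvectorUnitary : Matrix n n ℂ) = Z at hY
  rw [hY, quadForm_eq_sum]
  refine Finset.sum_le_sum fun i _ => Finset.sum_le_sum fun j _ => ?_
  have hp := hρ.eigenvalues_nonneg i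
  have hq := hσ.eigenvalues_nonneg j
  rw [weight]
  generalize hρ.1.eigenvalues i = p at *
  generalize hσ.1.eigenvalues j = q at *
  generalize transition hρ.1 hσ.1 i j = c
  generalize Z j i = z
  rcases hp.eq_or_lt with rfl | hp0
  · have := mul_nonneg hq (Complex.normSq_nonneg z)
    simpa using this
  have hs : 0 < t * p + q := add_pos_of_pos_of_nonneg (mul_pos ht hp0) hq
  generalize t * p + q = s at *
  rw [← mul_div_assoc, le_div_iff₀ hs, Complex.mul_re, Complex.normSq_apply, Complex.normSq_apply]
  -- completing the square: `|p c̄ - s z|² ≥ 0`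
  nlinarith [sq_nonneg (p * c.re - s * z.re), sq_nonneg (p * c.im + s * z.im)]

lemma exists_quadForm_eq_quadMax (hρ : ρ.IsHermitian) (hσ : σ.IsHermitian) (t : ℝ) :
    ∃ Y, quadForm ρ σ t Y = quadMax hρ hσ t := by
  refine ⟨_, (quadForm_eq_sum hρ hσ t (Matrix.of fun j i => ((hρ.eigenvalues i /
    (t * hρ.eigenvalues i + hσ.eigenvalues j) : ℝ) : ℂ) * star (transition hρ hσ i j))).trans ?_⟩
  refine Finset.sum_congr rfl fun i _ => Finset.sum_congr rfl fun j _ => ?_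
  rw [weight, of_apply]
  generalize hρ.eigenvalues i = p
  generalize transition hρ hσ i j = c
  generalize t * p + hσ.eigenvalues j = s
  rw [mul_left_comm c, Complex.star_def, Complex.mul_conj, ← Complex.ofReal_mul, Complex.ofReal_re,
    map_mul, Complex.normSq_conj, Complex.normSq_ofReal]
  rcases eq_or_ne s 0 with rfl | hs
  · simp
  · field_simp
    ring

end Variational

/-! ### Monotonicity of the relative entropy -/

section Monotone

open Matrix Filter Topology

variable {n : Type*} [Fintype n] [DecidableEq n] {ρ σ : Matrix n n ℂ}

/-- The function `∑ᵢⱼ wᵢⱼ pᵢ log (t pᵢ + qⱼ)`, where `pᵢ`, `qⱼ` are the eigenvalues of `ρ`, `σ` and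
`wᵢⱼ` are the weights. At `t = 0` it is `Tr ρ log σ`, and at infinity it is
`Tr ρ log ρ + log t Tr ρ + o(1)`. -/
noncomputable def logSum (hρ : ρ.IsHermitian) (hσ : σ.IsHermitian) (t : ℝ) : ℝ :=
  ∑ i, ∑ j, weight hρ hσ i j *
    (hρ.eigenvalues i * Real.log (t * hρ.eigenvalues i + hσ.eigenvalues j))

lemma logSum_zero (hρ : ρ.IsHermitian) (hσ : σ.IsHermitian) :
    logSum hρ hσ 0 = (trace (ρ * matLog σ)).re := by
  rw [matLog, trace_mul_cfc hρ hσ, logSum]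
  simp

lemma continuousOn_logSum (hρ : ρ.PosSemidef) (hσ : σ.PosSemidef) (h : KerLE σ ρ) :
    ContinuousOn (logSum hρ.1 hσ.1) (Set.Ici 0) := by
  refine continuousOn_finsetSum _ fun i _ => continuousOn_finsetSum _ fun j _ => ?_
  by_cases hw : weight hρ.1 hσ.1 i j * hρ.1.eigenvalues i = 0
  · simp only [← mul_assoc, hw, zero_mul]
    exact continuousOn_const
  have hq : 0 < hσ.1.eigenvalues j := (hσ.eigenvalues_nonneg j).lt_of_ne fun h0 =>
    hw (weight_mul_eq_zero hρ.1 hσ.1 h i j h0.symm)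
  refine continuousOn_const.mul (continuousOn_const.mul (ContinuousOn.log (by fun_prop) ?_))
  intro t ht
  exact (add_pos_of_nonneg_of_pos (mul_nonneg ht (hρ.eigenvalues_nonneg i)) hq).ne'

lemma hasDerivAt_logSum (hρ : ρ.PosSemidef) (hσ : σ.PosSemidef) {t : ℝ} (ht : 0 < t) :
    HasDerivAt (logSum hρ.1 hσ.1) (quadMax hρ.1 hσ.1 t) t := by
  refine HasDerivAt.fun_sum fun i _ => HasDerivAt.fun_sum fun j _ => HasDerivAt.const_mul _ ?_
  rcases (hρ.eigenvalues_nonneg i).eq_or_lt with hp | hp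
  · simp only [← hp, zero_mul]
    simpa using hasDerivAt_const t (0 : ℝ)
  · have hs : 0 < t * hρ.1.eigenvalues i + hσ.1.eigenvalues j :=
      add_pos_of_pos_of_nonneg (mul_pos ht hp) (hσ.eigenvalues_nonneg j)
    have h1 : HasDerivAt (fun t : ℝ => t * hρ.1.eigenvalues i + hσ.1.eigenvalues j)
        (hρ.1.eigenvalues i) t := by
      simpa using ((hasDerivAt_id t).mul_const (hρ.1.eigenvalues i)).add_const
        (hσ.1.eigenvalues j)
    have h2 := (h1.log hs.ne').const_mul (hρ.1.eigenvalues i)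
    convert h2 using 1
    ring

lemma tendsto_logSum (hρ : ρ.PosSemidef) (hσ : σ.PosSemidef) :
    Tendsto (fun t => logSum hρ.1 hσ.1 t - Real.log t * (trace ρ).re) atTop
      (𝓝 (trace (ρ * matLog ρ)).re) := by
  rw [matLog, trace_mul_cfc_self hρ.1 hσ.1]
  have hE : ∀ t, logSum hρ.1 hσ.1 t - Real.log t * (trace ρ).re =
      ∑ i, ∑ j, weight hρ.1 hσ.1 i j * (hρ.1.eigenvalues i *
        (Real.log (t * hρ.1.eigenvalues i + hσ.1.eigenvalues j) - Real.log t)) := by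
    intro t
    rw [logSum, trace_left hρ.1 hσ.1]
    simp only [Finset.mul_sum, ← Finset.sum_sub_distrib]
    refine Finset.sum_congr rfl fun i _ => Finset.sum_congr rfl fun j _ => ?_
    ring
  simp only [hE]
  refine tendsto_finsetSum _ fun i _ => tendsto_finsetSum _ fun j _ =>
    Tendsto.const_mul _ ?_
  rcases (hρ.eigenvalues_nonneg i).eq_or_lt with hp | hp
  · simp [← hp]
  refine Tendsto.const_mul _ ?_
  have h1 : Tendsto (fun t : ℝ => hρ.1.eigenvalues i + hσ.1.eigenvalues j / t) atTop
      (𝓝 (hρ.1.eigenvalues i)) := by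
    have h0 : Tendsto (fun t : ℝ => hσ.1.eigenvalues j / t) atTop (𝓝 0) :=
      tendsto_const_nhds.div_atTop tendsto_id
    simpa using h0.const_add (hρ.1.eigenvalues i)
  refine (h1.log hp.ne').congr' ?_
  filter_upwards [eventually_gt_atTop 0] with t ht
  have hs : 0 < t * hρ.1.eigenvalues i + hσ.1.eigenvalues j :=
    add_pos_of_pos_of_nonneg (mul_pos ht hp) (hσ.eigenvalues_nonneg j)
  rw [← Real.log_div hs.ne' ht.ne']
  congr 1
  field_simp

variable {m : Type*} [Fintype m] [DecidableEq m] {ρ' σ' : Matrix m m ℂ}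

open scoped MatrixOrder in
lemma mul_eq_zero_of_trace_mul_self_eq_zero (hσ : σ.PosSemidef) (Y : Matrix n n ℂ)
    (h : trace (σ * (Y * Yᴴ)) = 0) : σ * Y = 0 := by
  have h1 : (Yᴴ * σ * Y) = 0 := by
    rw [← (hσ.conjTranspose_mul_mul_same Y).trace_eq_zero_iff, trace_mul_comm,
      ← Matrix.mul_assoc, trace_mul_comm, h]
  obtain ⟨B, rfl⟩ := CStarAlgebra.nonneg_iff_eq_star_mul_self.1 hσ.nonneg
  rw [star_eq_conjTranspose] at *
  have h2 : (B * Y)ᴴ * (B * Y) = 0 := by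
    rw [← h1, conjTranspose_mul]
    simp only [Matrix.mul_assoc]
  rw [conjTranspose_mul_self_eq_zero] at h2
  rw [Matrix.mul_assoc, h2, Matrix.mul_zero]

/-- Inclusion of kernels passes to restrictions of functionals to a subalgebra. -/
lemma KerLE.restrict (φ : Matrix m m ℂ →⋆ₐ[ℂ] Matrix n n ℂ) (hσ : σ.PosSemidef)
    (hρ' : ρ'.PosSemidef)
    (eρ : ∀ Y, trace (ρ' * Y) = trace (ρ * φ Y)) (eσ : ∀ Y, trace (σ' * Y) = trace (σ * φ Y))
    (h : KerLE σ ρ) : KerLE σ' ρ' := by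
  intro Y hY
  have hφ : φ (Y * Yᴴ) = φ Y * (φ Y)ᴴ := by
    rw [map_mul, ← star_eq_conjTranspose, map_star, star_eq_conjTranspose]
  have h1 := eσ (Y * Yᴴ)
  rw [← Matrix.mul_assoc, hY, Matrix.zero_mul, trace_zero, hφ] at h1
  have h2 := h _ (mul_eq_zero_of_trace_mul_self_eq_zero hσ _ h1.symm)
  refine mul_eq_zero_of_trace_mul_self_eq_zero hρ' Y ?_
  rw [eρ, hφ, ← Matrix.mul_assoc, h2, Matrix.zero_mul, trace_zero]

/-- **Monotonicity of the relative entropy** under restriction to a `*`-subalgebra. The maximum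
defining the derivative of `logSum` only decreases when `Y` is restricted to the subalgebra, so the
difference of the two functions `logSum` increases from its value at `0`, which involves
`Tr ρ log σ`, to its limit at infinity, which involves `Tr ρ log ρ`. -/
theorem entropyGap_restrict_le (φ : Matrix m m ℂ →⋆ₐ[ℂ] Matrix n n ℂ)
    (hρ : ρ.PosSemidef) (hσ : σ.PosSemidef) (hρ' : ρ'.PosSemidef) (hσ' : σ'.PosSemidef)
    (eρ : ∀ Y, trace (ρ' * Y) = trace (ρ * φ Y)) (eσ : ∀ Y, trace (σ' * Y) = trace (σ * φ Y))
    (h : KerLE σ ρ) : entropyGap ρ' σ' ≤ entropyGap ρ σ := by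
  have h' : KerLE σ' ρ' := h.restrict φ hσ hρ' eρ eσ
  have hquad : ∀ t Y, quadForm ρ' σ' t Y = quadForm ρ σ t (φ Y) := by
    intro t Y
    simp only [quadForm, eρ, eσ, map_mul, ← star_eq_conjTranspose, map_star]
  have hmax : ∀ t, 0 < t → quadMax hρ'.1 hσ'.1 t ≤ quadMax hρ.1 hσ.1 t := by
    intro t ht
    obtain ⟨Y, hY⟩ := exists_quadForm_eq_quadMax hρ'.1 hσ'.1 t
    rw [← hY, hquad]
    exact quadForm_le_quadMax hρ hσ ht _
  have hmono : MonotoneOn (fun t => logSum hρ.1 hσ.1 t - logSum hρ'.1 hσ'.1 t) (Set.Ici 0) := by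
    refine monotoneOn_of_deriv_nonneg (convex_Ici 0)
      ((continuousOn_logSum hρ hσ h).sub (continuousOn_logSum hρ' hσ' h')) ?_ ?_
    · intro t ht
      rw [interior_Ici] at ht
      exact ((hasDerivAt_logSum hρ hσ ht).sub
        (hasDerivAt_logSum hρ' hσ' ht)).differentiableAt.differentiableWithinAt
    · intro t ht
      rw [interior_Ici] at ht
      rw [((hasDerivAt_logSum hρ hσ ht).fun_sub (hasDerivAt_logSum hρ' hσ' ht)).deriv]
      exact sub_nonneg.2 (hmax t ht)
  have htr : trace ρ' = trace ρ := by simpa using eρ 1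
  have hlim := (tendsto_logSum hρ hσ).sub (tendsto_logSum hρ' hσ')
  have hle := ge_of_tendsto hlim (b := logSum hρ.1 hσ.1 0 - logSum hρ'.1 hσ'.1 0) (by
    filter_upwards [eventually_ge_atTop 0] with t ht
    have := hmono Set.self_mem_Ici ht ht
    rw [htr]
    linarith)
  rw [logSum_zero, logSum_zero] at hle
  simp only [entropyGap, Matrix.mul_sub, trace_sub, Complex.sub_re]
  linarith

end Monotone

/-! ### Logarithm of the exponential of a compression -/

section Exponential

open Matrix

variable {n : Type*} [Fintype n] [DecidableEq n] {ρ σ : Matrix n n ℂ}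

lemma cfc_mulVec_of_mulVec_eq_smul (hρ : ρ.IsHermitian) (f : ℝ → ℝ) {v : n → ℂ} {r : ℝ}
    (h : ρ *ᵥ v = (r : ℂ) • v) : cfc f ρ *ᵥ v = (f r : ℂ) • v := by
  set U := (hρ.eigenvectorUnitary : Matrix n n ℂ) with hU
  have hUU : Uᴴ * U = 1 := eigenvectorUnitary_conjTranspose_mul hρ
  have hUU' : U * Uᴴ = 1 := eigenvectorUnitary_mul_conjTranspose hρ
  have e := eq_conj hρ
  rw [← hU] at e
  -- in eigencoordinates, only entries belonging to the eigenvalue `r` survive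
  have h1 : diagonal (fun i => (hρ.eigenvalues i : ℂ)) *ᵥ (Uᴴ *ᵥ v) = (r : ℂ) • (Uᴴ *ᵥ v) := by
    rw [← mulVec_smul, ← h]
    conv_rhs => enter [2, 1]; rw [e]
    simp only [mulVec_mulVec, ← Matrix.mul_assoc]
    rw [hUU, Matrix.one_mul]
  have h2 : diagonal (fun i => (f (hρ.eigenvalues i) : ℂ)) *ᵥ (Uᴴ *ᵥ v) =
      (f r : ℂ) • (Uᴴ *ᵥ v) := by
    ext i
    have h3 := congrFun h1 i
    rw [mulVec_diagonal, Pi.smul_apply, smul_eq_mul] at h3 ⊢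
    rcases mul_eq_mul_right_iff.1 h3 with h4 | h4
    · rw [Complex.ofReal_inj.1 h4]
    · rw [h4, mul_zero, mul_zero]
  rw [cfc_eq_conj hρ, ← hU, ← mulVec_mulVec, ← mulVec_mulVec, h2, mulVec_smul, mulVec_mulVec,
    hUU', one_mulVec]

lemma ext_of_eigenvectors (hρ : ρ.IsHermitian) {A B : Matrix n n ℂ}
    (h : ∀ (v : n → ℂ) (r : ℝ), ρ *ᵥ v = (r : ℂ) • v → A *ᵥ v = B *ᵥ v) : A = B := by
  have h1 : A * (hρ.eigenvectorUnitary : Matrix n n ℂ) =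
      B * (hρ.eigenvectorUnitary : Matrix n n ℂ) := by
    ext k i
    refine congrFun (h (fun l => (hρ.eigenvectorUnitary : Matrix n n ℂ) l i)
      (hρ.eigenvalues i) ?_) k
    have e := eq_conj hρ
    have h2 : ρ * (hρ.eigenvectorUnitary : Matrix n n ℂ) =
        (hρ.eigenvectorUnitary : Matrix n n ℂ) *
          diagonal (fun i => (hρ.eigenvalues i : ℂ)) := by
      conv_lhs => enter [1]; rw [e]
      rw [Matrix.mul_assoc, eigenvectorUnitary_conjTranspose_mul, Matrix.mul_one]
    ext l
    have h3 := congrFun (congrFun h2 l) i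
    rw [mul_diagonal] at h3
    rw [Pi.smul_apply, smul_eq_mul, mul_comm, ← h3]
    rfl
  have h4 := congrArg (· * (hρ.eigenvectorUnitary : Matrix n n ℂ)ᴴ) h1
  simpa only [Matrix.mul_assoc, eigenvectorUnitary_mul_conjTranspose, Matrix.mul_one] using h4

lemma exp_eq_cfc (hρ : ρ.IsHermitian) : NormedSpace.exp ρ = cfc Real.exp ρ := by
  have hinv : (hρ.eigenvectorUnitary : Matrix n n ℂ)⁻¹ =
      (hρ.eigenvectorUnitary : Matrix n n ℂ)ᴴ :=
    inv_eq_right_inv (eigenvectorUnitary_mul_conjTranspose hρ)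
  have hunit : IsUnit (hρ.eigenvectorUnitary : Matrix n n ℂ) :=
    ⟨⟨_, _, eigenvectorUnitary_mul_conjTranspose hρ, eigenvectorUnitary_conjTranspose_mul hρ⟩, rfl⟩
  conv_lhs => rw [eq_conj hρ, ← hinv]
  rw [exp_conj _ _ hunit, exp_diagonal, cfc_eq_conj hρ, hinv]
  congr 3
  ext i
  rw [Pi.coe_exp, ← Complex.exp_eq_exp_ℂ, Complex.ofReal_exp]

lemma isHermitian_cfc (f : ℝ → ℝ) (ρ : Matrix n n ℂ) : (cfc f ρ).IsHermitian :=
  cfc_predicate (p := IsSelfAdjoint) f ρ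

lemma posSemidef_cfc (hρ : ρ.IsHermitian) {f : ℝ → ℝ} (hf : ∀ i, 0 ≤ f (hρ.eigenvalues i)) :
    (cfc f ρ).PosSemidef := by
  rw [cfc_eq_conj hρ]
  refine PosSemidef.mul_mul_conjTranspose_same (PosSemidef.diagonal fun i => ?_) _
  exact Complex.zero_le_real.2 (hf i)

lemma projMatrix_mul_self (K : Submodule ℂ (EuclideanSpace ℂ n)) :
    projMatrix K * projMatrix K = projMatrix K := by
  rw [projMatrix, ← map_mul, K.isIdempotentElem_starProjection.eq]

lemma isHermitian_projMatrix (K : Submodule ℂ (EuclideanSpace ℂ n)) :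
    (projMatrix K).IsHermitian := by
  have h := (toEuclideanCLM (n := n) (𝕜 := ℂ)).symm.map_star' K.starProjection
  rw [(isSelfAdjoint_starProjection K).star_eq] at h
  exact h.symm

lemma supp_projMatrix (K : Submodule ℂ (EuclideanSpace ℂ n)) : supp (projMatrix K) = K := by
  have h : ∀ v, toEuclideanLin (projMatrix K) v = K.starProjection v := by
    intro v
    have := congrArg (fun T => T v)
      ((toEuclideanCLM (n := n) (𝕜 := ℂ)).apply_symm_apply K.starProjection)
    exact this
  ext v
  constructor
  · rintro ⟨w, rfl⟩
    rw [h]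
    exact K.starProjection_apply_mem w
  · intro hv
    exact ⟨v, by rw [h, Submodule.starProjection_eq_self_iff.2 hv]⟩

/-- For Hermitian matrices, the kernel is the orthogonal complement of the support. -/
lemma kerLE_of_supp_le (hρ : ρ.IsHermitian) (hσ : σ.IsHermitian) (h : supp ρ ≤ supp σ) :
    KerLE σ ρ := by
  have sρ := isSymmetric_toEuclideanLin_iff.2 hρ
  have sσ := isSymmetric_toEuclideanLin_iff.2 hσ
  have key : ∀ y, toEuclideanLin σ y = 0 → toEuclideanLin ρ y = 0 := by
    intro y hy
    refine inner_self_eq_zero (𝕜 := ℂ).1 ?_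
    obtain ⟨z, hz⟩ := h ⟨toEuclideanLin ρ y, rfl⟩
    rw [← sρ, ← hz, sσ, hy, inner_zero_right]
  intro Y hY
  ext i j
  have h1 := key (WithLp.toLp 2 (fun k => Y k j)) (by
    ext k
    exact congrFun (congrFun hY k) j)
  exact congrArg (fun v => v i) h1

/-- The operator whose compression is exponentiated in `expLog`. -/
noncomputable def logCombination (M L N : Matrix n n ℂ) : Matrix n n ℂ :=
  matLog M - matLog L + matLog N

lemma isHermitian_logCombination (M L N : Matrix n n ℂ) : (logCombination M L N).IsHermitian :=
  ((isHermitian_cfc _ _).sub (isHermitian_cfc _ _)).add (isHermitian_cfc _ _)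

/-- `exp` of the compression of `H` to `K`, extended by `0` to the orthogonal complement. -/
noncomputable def expCompression (K : Submodule ℂ (EuclideanSpace ℂ n)) (H : Matrix n n ℂ) :
    Matrix n n ℂ :=
  projMatrix K * NormedSpace.exp (projMatrix K * H * projMatrix K) * projMatrix K

variable {H : Matrix n n ℂ} (K : Submodule ℂ (EuclideanSpace ℂ n))

lemma isHermitian_compression (hH : H.IsHermitian) :
    (projMatrix K * H * projMatrix K).IsHermitian := by
  have := isHermitian_mul_mul_conjTranspose (projMatrix K) hH
  rwa [(isHermitian_projMatrix K).eq] at this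

lemma posSemidef_expCompression (hH : H.IsHermitian) : (expCompression K H).PosSemidef := by
  have h := (posSemidef_cfc (isHermitian_compression K hH) (f := Real.exp)
    fun i => (Real.exp_pos _).le).mul_mul_conjTranspose_same (projMatrix K)
  rwa [(isHermitian_projMatrix K).eq, ← exp_eq_cfc (isHermitian_compression K hH)] at h

/-- The logarithm (with `log 0 = 0`) of the exponential of a compression is the compression. -/
lemma matLog_expCompression (hH : H.IsHermitian) :
    matLog (expCompression K H) = projMatrix K * H * projMatrix K := by
  have hG := isHermitian_compression K hH
  have hX := (posSemidef_expCompression K hH).1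
  have hPP := projMatrix_mul_self K
  have hXdef : expCompression K H =
    projMatrix K * NormedSpace.exp (projMatrix K * H * projMatrix K) * projMatrix K := rfl
  have hPG : projMatrix K * (projMatrix K * H * projMatrix K) =
      projMatrix K * H * projMatrix K := by
    simp only [← Matrix.mul_assoc, hPP]
  have hGP : (projMatrix K * H * projMatrix K) * projMatrix K =
      projMatrix K * H * projMatrix K := by
    rw [Matrix.mul_assoc, hPP]
  rw [exp_eq_cfc hG] at hXdef
  generalize projMatrix K * H * projMatrix K = G at *
  generalize projMatrix K = P at *
  generalize expCompression K H = X at *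
  have hexp : ∀ (v : n → ℂ) (r : ℝ), G *ᵥ v = (r : ℂ) • v → P *ᵥ v = v →
      X *ᵥ v = (Real.exp r : ℂ) • v := by
    intro v r hv hP
    rw [hXdef, ← mulVec_mulVec, ← mulVec_mulVec, hP, cfc_mulVec_of_mulVec_eq_smul hG _ hv,
      mulVec_smul, hP]
  refine ext_of_eigenvectors hG fun v r hv => ?_
  rcases eq_or_ne r 0 with rfl | hr
  · -- split `v` along the projection: `X` acts as `1` on `P v` and as `0` on `v - P v`
    have hGv : G *ᵥ v = 0 := by simpa using hv
    have hGPv : G *ᵥ (P *ᵥ v) = ((0 : ℝ) : ℂ) • (P *ᵥ v) := by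
      rw [mulVec_mulVec, hGP, hGv, Complex.ofReal_zero, zero_smul]
    have h1 := hexp _ _ hGPv (by rw [mulVec_mulVec, hPP])
    have h2 : X *ᵥ (v - P *ᵥ v) = ((0 : ℝ) : ℂ) • (v - P *ᵥ v) := by
      rw [hXdef, ← mulVec_mulVec, mulVec_sub P, mulVec_mulVec, hPP, sub_self, mulVec_zero,
        Complex.ofReal_zero, zero_smul]
    have h3 := cfc_mulVec_of_mulVec_eq_smul hX Real.log h1
    have h4 := cfc_mulVec_of_mulVec_eq_smul hX Real.log h2
    rw [Real.log_exp, Complex.ofReal_zero, zero_smul] at h3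
    rw [Real.log_zero, Complex.ofReal_zero, zero_smul, mulVec_sub, h3, sub_zero] at h4
    rw [matLog, h4, hGv]
  · have hPv : P *ᵥ v = v := by
      have h1 : v = (r : ℂ)⁻¹ • (G *ᵥ v) := by
        rw [hv, smul_smul, inv_mul_cancel₀ (Complex.ofReal_ne_zero.2 hr), one_smul]
      conv_lhs => rw [h1]
      rw [mulVec_smul, mulVec_mulVec, hPG, ← h1]
    rw [matLog, cfc_mulVec_of_mulVec_eq_smul hX _ (hexp v r hv hPv), Real.log_exp, hv]

lemma kerLE_expCompression (hK : K ≤ supp σ) (hσ : σ.IsHermitian) :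
    KerLE σ (expCompression K H) := by
  intro Y hY
  have h := kerLE_of_supp_le (isHermitian_projMatrix K) hσ (by rwa [supp_projMatrix]) Y hY
  rw [expCompression, Matrix.mul_assoc, h, Matrix.mul_zero]

lemma trace_expCompression_mul_matLog (hH : H.IsHermitian) :
    trace (expCompression K H * matLog (expCompression K H)) =
      trace (expCompression K H * H) := by
  have h1 : expCompression K H * projMatrix K = expCompression K H := by
    rw [expCompression, Matrix.mul_assoc, projMatrix_mul_self]
  have h2 : projMatrix K * expCompression K H = expCompression K H := by
    rw [expCompression, ← Matrix.mul_assoc, ← Matrix.mul_assoc, projMatrix_mul_self]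
  rw [matLog_expCompression K hH, ← Matrix.mul_assoc, ← Matrix.mul_assoc, h1, trace_mul_comm,
    ← Matrix.mul_assoc, h2]

end Exponential

/-! ### Partial traces and tensoring with identities -/

section Marginals

open Matrix

variable {a b c : Type*}

lemma margAC_posSemidef [Fintype b] {X : Matrix (a × b × c) (a × b × c) ℂ} (hX : X.PosSemidef) :
    (margAC X).PosSemidef := by
  have h : margAC X = ∑ y : b, X.submatrix (fun i : a × c => (i.1, y, i.2))
      (fun i : a × c => (i.1, y, i.2)) := by
    ext i j
    simp [margAC, Matrix.sum_apply]
  rw [h]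
  exact posSemidef_sum _ fun y _ => hX.submatrix _

lemma margBC_posSemidef [Fintype a] {X : Matrix (a × b × c) (a × b × c) ℂ} (hX : X.PosSemidef) :
    (margBC X).PosSemidef := by
  have h : margBC X = ∑ x : a, X.submatrix (fun i : b × c => (x, i)) (fun i => (x, i)) := by
    ext i j
    simp [margBC, Matrix.sum_apply]
  rw [h]
  exact posSemidef_sum _ fun y _ => hX.submatrix _

lemma margC_posSemidef [Fintype a] [Fintype b] {σ : Matrix (a × b × c) (a × b × c) ℂ}
    (hσ : σ.PosSemidef) : (margC σ).PosSemidef := by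
  have h : margC σ = ∑ x : a, ∑ y : b, σ.submatrix (fun i : c => (x, y, i))
      (fun i => (x, y, i)) := by
    ext i j
    simp [margC, Matrix.sum_apply]
  rw [h]
  exact posSemidef_sum _ fun x _ => posSemidef_sum _ fun y _ => hσ.submatrix _

lemma margAC_liftBC_margBC [Fintype a] [Fintype b] [DecidableEq a]
    (σ : Matrix (a × b × c) (a × b × c) ℂ) :
    margAC (liftBC (a := a) (margBC σ)) = (1 : Matrix a a ℂ) ⊗ₖ margC σ := by
  ext i j
  simp only [margAC, liftBC, kroneckerMap_apply, margBC, margC]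
  exact (Finset.mul_sum _ _ _).symm.trans
    (congrArg (fun z : ℂ => (1 : Matrix a a ℂ) i.1 j.1 * z) Finset.sum_comm)

variable [Fintype a] [Fintype b] [Fintype c] [DecidableEq a] [DecidableEq b] [DecidableEq c]

variable (a b c) in
/-- Tensoring with the identity of `B`, as a homomorphism of `*`-algebras. -/
def liftACHom : Matrix (a × c) (a × c) ℂ →⋆ₐ[ℂ] Matrix (a × b × c) (a × b × c) ℂ where
  toFun := liftAC
  map_one' := by
    ext i j
    simp [liftAC, one_apply, Prod.ext_iff, and_comm, and_left_comm, ite_and]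
  map_mul' M N := by
    let e : a × b × c ≃ (a × c) × b :=
      ⟨fun i => ((i.1, i.2.2), i.2.1), fun i => (i.1.1, i.2, i.1.2), fun _ => rfl, fun _ => rfl⟩
    have h : ∀ M : Matrix (a × c) (a × c) ℂ,
      liftAC (b := b) M = (M ⊗ₖ (1 : Matrix b b ℂ)).submatrix e e := fun _ => rfl
    rw [h, h, h, submatrix_mul_equiv, ← mul_kronecker_mul, Matrix.one_mul]
  map_zero' := by
    ext i j
    simp [liftAC]
  map_add' M N := by
    rw [liftAC, add_kronecker]
    rfl
  commutes' r := by
    ext i j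
    simp only [liftAC, algebraMap_matrix_apply, submatrix_apply, kroneckerMap_apply, one_apply,
      Prod.ext_iff]
    split_ifs <;> simp_all
  map_star' M := by
    simp only [star_eq_conjTranspose, liftAC, conjTranspose_submatrix, conjTranspose_kronecker,
      conjTranspose_one]

/-- The partial trace over `B` is dual to tensoring with the identity of `B`. -/
lemma trace_margAC_mul (X : Matrix (a × b × c) (a × b × c) ℂ) (Y : Matrix (a × c) (a × c) ℂ) :
    trace (margAC X * Y) = trace (X * liftACHom a b c Y) := by
  change trace (margAC X * Y) = trace (X * liftAC Y)
  simp only [trace, diag_apply, mul_apply, margAC, liftAC, submatrix_apply, kroneckerMap_apply,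
    one_apply, Fintype.sum_prod_type, Finset.sum_mul, mul_ite, mul_one, mul_zero]
  refine Finset.sum_congr rfl fun x _ => ?_
  simp only [Finset.sum_ite_eq', Finset.mem_univ, if_true, Finset.sum_ite_irrel,
    Finset.sum_const_zero]
  rw [Finset.sum_comm (γ := b)]
  refine Finset.sum_congr rfl fun z _ => ?_
  rw [Finset.sum_comm (γ := b)]
  refine Finset.sum_congr rfl fun x' _ => ?_
  rw [Finset.sum_comm (γ := b)]

lemma matLog_liftACHom {M : Matrix (a × c) (a × c) ℂ} (hM : M.IsHermitian) :
    liftACHom a b c (matLog M) = matLog (liftACHom a b c M) := by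
  have hφ : Continuous (liftACHom a b c) :=
    LinearMap.continuous_of_finiteDimensional
      ((liftACHom a b c).toAlgHom.toLinearMap)
  exact StarAlgHom.map_cfc (p := IsSelfAdjoint) (q := IsSelfAdjoint) (liftACHom a b c) Real.log M
    (continuousOn_spectrum _ _) hφ hM.isSelfAdjoint (hM.isSelfAdjoint.map _)

lemma liftACHom_one_kronecker (M : Matrix c c ℂ) :
    liftACHom a b c ((1 : Matrix a a ℂ) ⊗ₖ M) = liftC M := by
  ext i j
  change liftAC ((1 : Matrix a a ℂ) ⊗ₖ M) i j = _
  simp only [liftAC, liftC, submatrix_apply, kroneckerMap_apply]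
  ring

end Marginals

/-! ### The trace bound -/

section TraceBound

open Matrix

variable {a b c : Type*} [Fintype a] [Fintype b] [Fintype c]
  [DecidableEq a] [DecidableEq b] [DecidableEq c] {σ : Matrix (a × b × c) (a × b × c) ℂ}

lemma isHermitian_liftACHom {M : Matrix (a × c) (a × c) ℂ} (hM : M.IsHermitian) :
    (liftACHom a b c M).IsHermitian :=
  hM.isSelfAdjoint.map (liftACHom a b c)

lemma trace_margAC (σ : Matrix (a × b × c) (a × b × c) ℂ) : trace (margAC σ) = trace σ := by
  simpa using trace_margAC_mul σ 1

lemma posSemidef_expMarg (σ : Matrix (a × b × c) (a × b × c) ℂ) : (expMarg σ).PosSemidef :=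
  posSemidef_expCompression _ (isHermitian_logCombination _ _ _)

/-- With `X = expMarg σ`, the identity `Tr X log X = Tr X (log σ_AC - log σ_C + log σ_BC)` splits
into `S(X‖σ_BC) - S(X_AC‖σ_C) + S(X_AC‖σ_AC) = 0`. The difference is nonnegative by
monotonicity, and the last term is at least `Tr X - 1` by Klein's inequality. -/
theorem trace_expMarg_le_one (hσ : IsState σ) : (trace (expMarg σ)).re ≤ 1 := by
  have hX := posSemidef_expMarg σ
  have hAC := margAC_posSemidef hσ.posSemidef
  have hN : (liftBC (a := a) (margBC σ)).PosSemidef :=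
    PosSemidef.one.kronecker (margBC_posSemidef hσ.posSemidef)
  have hC : ((1 : Matrix a a ℂ) ⊗ₖ margC σ).PosSemidef :=
    PosSemidef.one.kronecker (margC_posSemidef hσ.posSemidef)
  have hXAC := margAC_posSemidef hX
  have kM : KerLE (liftACHom a b c (margAC σ)) (expMarg σ) :=
    kerLE_expCompression _ inf_le_left (isHermitian_liftACHom hAC.1)
  have kN : KerLE (liftBC (margBC σ)) (expMarg σ) :=
    kerLE_expCompression _ inf_le_right hN.1
  have kAC : KerLE (margAC σ) (margAC (expMarg σ)) := by
    intro Y hY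
    refine mul_eq_zero_of_trace_mul_self_eq_zero hXAC Y ?_
    rw [trace_margAC_mul, map_mul, ← Matrix.mul_assoc,
      kM _ (by rw [← map_mul, hY, map_zero]), Matrix.zero_mul, trace_zero]
  have hklein := trace_sub_trace_le_entropyGap hXAC hAC kAC
  rw [trace_margAC, trace_margAC, hσ.trace_eq_one, Complex.one_re] at hklein
  have hmono := entropyGap_restrict_le (liftACHom a b c) hX hN hXAC hC (trace_margAC_mul _)
    (fun Y => by rw [← margAC_liftBC_margBC, trace_margAC_mul]) kN
  have hlog : trace (expMarg σ * matLog (expMarg σ)) = trace (expMarg σ *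
      (matLog (liftAC (margAC σ)) - matLog (liftC (margC σ)) + matLog (liftBC (margBC σ)))) :=
    trace_expCompression_mul_matLog _ (isHermitian_logCombination _ _ _)
  have e1 : trace (margAC (expMarg σ) * matLog (margAC σ)) =
      trace (expMarg σ * matLog (liftAC (margAC σ))) := by
    rw [trace_margAC_mul, matLog_liftACHom hAC.1]
    rfl
  have e2 : trace (margAC (expMarg σ) * matLog ((1 : Matrix a a ℂ) ⊗ₖ margC σ)) =
      trace (expMarg σ * matLog (liftC (margC σ))) := by
    rw [trace_margAC_mul, matLog_liftACHom hC.1, liftACHom_one_kronecker]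
  simp only [entropyGap, Matrix.mul_sub, Matrix.mul_add, trace_sub, trace_add, Complex.sub_re,
    hlog, Complex.add_re, e1, e2] at hklein hmono
  linarith

end TraceBound

/-! ### Differences of square roots and the trace norm -/

section SqrtDifference

open Matrix

variable {n : Type*} [Fintype n] [DecidableEq n] {ρ σ : Matrix n n ℂ}

lemma matSqrt_mul_self (hρ : ρ.PosSemidef) : matSqrt ρ * matSqrt ρ = ρ := by
  rw [matSqrt, cfc_eq_conj hρ.1]
  simp only [Matrix.mul_assoc]
  rw [← Matrix.mul_assoc _ _ (diagonal _ * _), eigenvectorUnitary_conjTranspose_mul,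
    Matrix.one_mul, ← Matrix.mul_assoc (diagonal _), diagonal_mul_diagonal]
  conv_rhs => rw [eq_conj hρ.1]
  simp only [← Complex.ofReal_mul, Real.mul_self_sqrt (hρ.eigenvalues_nonneg _),
    ← Matrix.mul_assoc]

lemma norm2_sq {n : Type*} [Fintype n] (T : Matrix n n ℂ) : norm2 T ^ 2 = (trace (Tᴴ * T)).re :=
  Real.sq_sqrt (Complex.nonneg_iff.1 (posSemidef_conjTranspose_mul_self T).trace_nonneg).1

lemma norm2_matSqrt_sub_sq (hρ : ρ.PosSemidef) (hσ : σ.PosSemidef) :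
    norm2 (matSqrt ρ - matSqrt σ) ^ 2 = (trace ρ).re + (trace σ).re - 2 * overlap ρ σ := by
  have h1 : (matSqrt ρ)ᴴ = matSqrt ρ := isHermitian_cfc _ _
  have h2 : (matSqrt σ)ᴴ = matSqrt σ := isHermitian_cfc _ _
  rw [norm2_sq, conjTranspose_sub, h1, h2]
  simp only [Matrix.sub_mul, Matrix.mul_sub, trace_sub, matSqrt_mul_self hρ, matSqrt_mul_self hσ,
    trace_mul_comm (matSqrt σ) (matSqrt ρ), Complex.sub_re]
  rw [overlap]
  ring

lemma overlap_nonneg (hρ : ρ.IsHermitian) (hσ : σ.IsHermitian) : 0 ≤ overlap ρ σ := by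
  rw [overlap_eq_sum hρ hσ]
  exact Finset.sum_nonneg fun i _ => Finset.sum_nonneg fun j _ => mul_nonneg
    (weight_nonneg _ _ _ _) (mul_nonneg (Real.sqrt_nonneg _) (Real.sqrt_nonneg _))

/-- A Hermitian `T` has a sign: a Hermitian contraction `W` with `Tr W T = ‖T‖₁`. -/
lemma exists_sign {T : Matrix n n ℂ} (hT : T.IsHermitian) :
    ∃ W : Matrix n n ℂ, W.IsHermitian ∧ (1 - W * W).PosSemidef ∧
      norm1 T = (trace (W * T)).re := by
  refine ⟨cfc (fun x : ℝ => (SignType.sign x : ℝ)) T, isHermitian_cfc _ _, ?_, ?_⟩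
  · have h : 1 - cfc (fun x : ℝ => (SignType.sign x : ℝ)) T *
        cfc (fun x : ℝ => (SignType.sign x : ℝ)) T =
        cfc (fun x : ℝ => 1 - (SignType.sign x : ℝ) * (SignType.sign x : ℝ)) T := by
      rw [cfc_sub _ _ T (continuousOn_spectrum _ _) (continuousOn_spectrum _ _),
        cfc_mul _ _ T (continuousOn_spectrum _ _) (continuousOn_spectrum _ _),
        cfc_const_one ℝ T hT.isSelfAdjoint]
    rw [h]
    refine posSemidef_cfc hT fun i => ?_
    rcases lt_trichotomy (hT.eigenvalues i) 0 with hi | hi | hi <;> simp [hi]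
  · have h1 : Tᴴ * T = cfc (fun x : ℝ => x * x) T := by
      rw [cfc_mul _ _ T (continuousOn_spectrum _ _) (continuousOn_spectrum _ _),
        cfc_id' ℝ T hT.isSelfAdjoint, hT.eq]
    have h2 : matSqrt (Tᴴ * T) = cfc (fun x : ℝ => Real.sqrt (x * x)) T := by
      rw [matSqrt, h1]
      exact (cfc_comp' Real.sqrt (fun x : ℝ => x * x) T
        (((T.finite_real_spectrum).image _).continuousOn _) (continuousOn_spectrum _ _)
        hT.isSelfAdjoint).symm
    have h3 : cfc (fun x : ℝ => (SignType.sign x : ℝ)) T * T =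
        cfc (fun x : ℝ => Real.sqrt (x * x)) T := by
      have h4 : (fun x : ℝ => Real.sqrt (x * x)) = fun x : ℝ => (SignType.sign x : ℝ) * x := by
        funext x
        rw [Real.sqrt_mul_self_eq_abs, sign_mul_self]
      rw [h4, cfc_mul _ _ T (continuousOn_spectrum _ _) (continuousOn_spectrum _ _),
        cfc_id' ℝ T hT.isSelfAdjoint]
    rw [norm1, h2, h3]

/-- A Powers–Størmer type bound for matrices of trace at most one. With `D = √ρ - √σ`,
`S = √ρ + √σ` and `W` the sign of `ρ - σ = (DS + SD)/2`, one has `‖ρ - σ‖₁ = Re Tr W D S`, and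
`Tr S² ≤ 4`. -/
lemma norm1_sub_sq_le (hρ : ρ.PosSemidef) (hσ : σ.PosSemidef) (tρ : (trace ρ).re ≤ 1)
    (tσ : (trace σ).re ≤ 1) :
    1 / 4 * norm1 (ρ - σ) ^ 2 ≤ norm2 (matSqrt ρ - matSqrt σ) ^ 2 := by
  obtain ⟨W, hW, hW1, hWn⟩ := exists_sign (hρ.1.sub hσ.1)
  have hA : (matSqrt ρ)ᴴ = matSqrt ρ := isHermitian_cfc _ _
  have hB : (matSqrt σ)ᴴ = matSqrt σ := isHermitian_cfc _ _
  have hS : (trace ((matSqrt ρ + matSqrt σ) * (matSqrt ρ + matSqrt σ))).re ≤ 4 := by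
    have h1 := sq_nonneg (norm2 (matSqrt ρ - matSqrt σ))
    rw [norm2_matSqrt_sub_sq hρ hσ, overlap] at h1
    simp only [Matrix.add_mul, Matrix.mul_add, trace_add, matSqrt_mul_self hρ,
      matSqrt_mul_self hσ, trace_mul_comm (matSqrt σ) (matSqrt ρ), Complex.add_re]
    linarith
  have hDS : ρ - σ = (1 / 2 : ℂ) • ((matSqrt ρ - matSqrt σ) * (matSqrt ρ + matSqrt σ) +
      (matSqrt ρ + matSqrt σ) * (matSqrt ρ - matSqrt σ)) := by
    conv_lhs => rw [← matSqrt_mul_self hρ, ← matSqrt_mul_self hσ]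
    simp only [Matrix.add_mul, Matrix.mul_add, Matrix.sub_mul, Matrix.mul_sub]
    module
  have hDh : (matSqrt ρ - matSqrt σ)ᴴ = matSqrt ρ - matSqrt σ := by
    rw [conjTranspose_sub, hA, hB]
  have hSh : (matSqrt ρ + matSqrt σ)ᴴ = matSqrt ρ + matSqrt σ := by
    rw [conjTranspose_add, hA, hB]
  rw [norm2_sq, hDh]
  generalize matSqrt ρ - matSqrt σ = D at *
  generalize matSqrt ρ + matSqrt σ = S at *
  generalize hν : norm1 (ρ - σ) = ν at *
  have hconj : (trace (S * D * W)).re = (trace (W * D * S)).re := by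
    have h1 : (W * D * S)ᴴ = S * D * W := by
      rw [conjTranspose_mul, conjTranspose_mul, hDh, hSh, hW.eq, Matrix.mul_assoc]
    rw [← h1, trace_conjTranspose, Complex.star_def, Complex.conj_re]
  have hν1 : ν = (trace (W * D * S)).re := by
    rw [hWn, hDS, Matrix.mul_smul, trace_smul, Matrix.mul_add, trace_add, ← Matrix.mul_assoc,
      trace_mul_comm W (S * D), smul_eq_mul]
    have h2 : (1 / 2 : ℂ) = ((1 / 2 : ℝ) : ℂ) := by norm_num
    rw [h2, Complex.re_ofReal_mul, Complex.add_re, hconj]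
    ring
  have hWD : (trace (D * (W * W) * D)).re ≤ (trace (D * D)).re := by
    have h1 := (hW1.conjTranspose_mul_mul_same D).trace_nonneg
    rw [hDh, Matrix.mul_sub, Matrix.sub_mul, Matrix.mul_one, trace_sub] at h1
    have h2 := (Complex.nonneg_iff.1 h1).1
    rw [Complex.sub_re] at h2
    linarith
  -- Cauchy–Schwarz for `W D` and `S`, with the multiplier that is optimal when `Tr S² = 4`
  have hpos := (Complex.nonneg_iff.1 (posSemidef_conjTranspose_mul_self
    (W * D - ((ν / 4 : ℝ) : ℂ) • S)).trace_nonneg).1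
  have hexp : (trace ((W * D - ((ν / 4 : ℝ) : ℂ) • S)ᴴ * (W * D - ((ν / 4 : ℝ) : ℂ) • S))).re =
      (trace (D * (W * W) * D)).re - ν / 4 * (2 * ν) + (ν / 4) ^ 2 * (trace (S * S)).re := by
    rw [conjTranspose_sub, conjTranspose_smul, conjTranspose_mul, hDh, hSh, hW.eq,
      Complex.star_def, Complex.conj_ofReal]
    simp only [Matrix.sub_mul, Matrix.mul_sub, Matrix.smul_mul, Matrix.mul_smul, trace_sub,
      trace_smul, smul_eq_mul, Complex.sub_re, Complex.re_ofReal_mul]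
    have h1 : (trace (S * (W * D))).re = ν := by
      rw [hν1, trace_mul_comm]
    have h2 : (trace (D * W * S)).re = ν := by
      have h3 : (S * (W * D))ᴴ = D * W * S := by
        rw [conjTranspose_mul, conjTranspose_mul, hDh, hSh, hW.eq]
      rw [← h3, trace_conjTranspose, Complex.star_def, Complex.conj_re, h1]
    rw [h1, h2, Matrix.mul_assoc D W (W * D), ← Matrix.mul_assoc W W D,
      ← Matrix.mul_assoc D (W * W) D]
    ring
  rw [hexp] at hpos
  nlinarith [mul_le_mul_of_nonneg_left hS (sq_nonneg (ν / 4))]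

end SqrtDifference

end QInfo

theorem mainTheorem4 {a b c : Type*} [Fintype a] [Fintype b] [Fintype c]
    [DecidableEq a] [DecidableEq b] [DecidableEq c]
    (ρ σ : Matrix (a × b × c) (a × b × c) ℂ)
    (hρ : QInfo.IsState ρ) (hσ : QInfo.IsState σ) :
    -- `ENNReal.log 0 = ⊥`, so the middle term is `⊤` when the overlap vanishes
    -(2 * ENNReal.log (ENNReal.ofReal (QInfo.overlap ρ (QInfo.expMarg σ))))
        ≤ QInfo.relEntropy ρ (QInfo.expMarg σ) ∧
      ((QInfo.norm2 (QInfo.matSqrt ρ - QInfo.matSqrt (QInfo.expMarg σ)) ^ 2 : ℝ) : EReal)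
        ≤ -(2 * ENNReal.log (ENNReal.ofReal (QInfo.overlap ρ (QInfo.expMarg σ)))) ∧
      1 / 4 * QInfo.norm1 (ρ - QInfo.expMarg σ) ^ 2
        ≤ QInfo.norm2 (QInfo.matSqrt ρ - QInfo.matSqrt (QInfo.expMarg σ)) ^ 2 := by
  have hX := QInfo.posSemidef_expMarg σ
  have hT := QInfo.trace_expMarg_le_one hσ
  have hlog : ∀ {F : ℝ}, 0 < F →
      -(2 * ENNReal.log (ENNReal.ofReal F)) = ((-(2 * Real.log F) : ℝ) : EReal) := by
    intro F hF
    rw [ENNReal.log_ofReal_of_pos hF]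
    push_cast
    rfl
  refine ⟨?_, ?_, QInfo.norm1_sub_sq_le hρ.posSemidef hX (by simp [hρ.trace_eq_one]) hT⟩
  · rw [QInfo.relEntropy]
    split_ifs with h
    · have hk := QInfo.kerLE_of_supp_le hρ.posSemidef.1 hX.1 h
      rw [hlog (QInfo.overlap_pos hρ hX hk)]
      exact EReal.coe_le_coe_iff.2 (QInfo.neg_two_mul_log_overlap_le hρ hX hk)
    · exact le_top
  · rcases (QInfo.overlap_nonneg hρ.posSemidef.1 hX.1).eq_or_lt with h0 | h0
    · have : -(2 * ENNReal.log (ENNReal.ofReal (QInfo.overlap ρ (QInfo.expMarg σ)))) = ⊤ := by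
        rw [← h0, ENNReal.ofReal_zero, ENNReal.log_zero, EReal.mul_bot_of_pos (by norm_num),
          EReal.neg_bot]
      rw [this]
      exact le_top
    · rw [hlog h0, EReal.coe_le_coe_iff, QInfo.norm2_matSqrt_sub_sq hρ.posSemidef hX,
        hρ.trace_eq_one, Complex.one_re]
      have := Real.log_le_sub_one_of_pos h0
      linarith
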